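/- Consider the star of $m\ge 2$ unbounded rays $0,\dots,m-1$ with common origin $O$. A search strategy is an infinite sequence $X=(x_i,u_i)_{i\ge 0}$ with $x_i>0$ and $u_i\in\{0,\dots,m-1\}$: in iteration $i$ a unit-speed searcher starts at $O$, traverses ray $u_i$ up to distance $x_i$, and returns to $O$. A target $t$ hides on some ray at distance $d(t)\ge d_0$ from $O$, where $d_0>0$ is fixed, and $d(X,t)\in(0,\infty]$ is the distance covered by the searcher until the target is first reached ($\infty$ if it is never reached). Given a predicted ray $h$ (directional prediction), the searcher follows a strategy $X=X_h$. Its consistency is $\sup_t d(X,t)/d(t)$ over the targets $t$ on ray $h$, and its robustness is $\sup_t d(X,t)/d(t)$ over all targets $t$. Put $\rho^*_k=\dfrac{k^k}{(k-1)^{k-1}}$ for $k\ge 1$ (with $0^0=1$). Theorem. Let $m\ge 2$, $d_0>0$, let $h$ be the predicted ray, and let $\tilde c$ be a real number. If $X$ is $(1+2\tilde c)$-consistent, i.e. has consistency at most $1+2\tilde c$, then $\tilde c>1$, and the robustness of $X$ is at least $$1+2\rho^*_{m-1}\Bigl(1+\frac1{\tilde c-1}\Bigr).$$ In particular, as $m\to\infty$,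 the robustness is at least $(1-o(1))\bigl(1+2e(m-1)(1+\frac1{\tilde c-1})\bigr)$, where the $o(1)$ term depends only on $m$: for every $\varepsilon>0$ there is an $M$ such that for all $m\ge M$, all $d_0>0$, every predicted ray $h$ and every real $\tilde c$, every $(1+2\tilde c)$-consistent strategy $X$ has robustness at least $$(1-\varepsilon)\Bigl(1+2e(m-1)\Bigl(1+\frac1{\tilde c-1}\Bigr)\Bigr).$$ -/

import Mathlib

namespace RaySearch

/-- A strategy for searching the star formed by `m` rays with common origin `O`.
In iteration `i` the searcher starts at `O`, traverses the ray `ray i` up to distance `len i`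
from `O`, returns to `O`, and continues with iteration `i + 1`. -/
structure Strategy (m : ℕ) where
  len : ℕ → ℝ
  ray : ℕ → Fin m
  len_pos : ∀ i, 0 < len i

/-- A target hiding on one of the `m` rays at distance `dist` from the origin, where targets are
known to lie at distance at least `d₀` from the origin. -/
structure Target (m : ℕ) (d₀ : ℝ) where
  ray : Fin m
  dist : ℝ
  le_dist : d₀ ≤ dist

variable {m : ℕ} {d₀ : ℝ}

/-- The searcher reaches the target in iteration `n` (not necessarily for the first time). -/
def Strategy.Reaches (X : Strategy m) (t : Target m d₀) (n : ℕ) : Prop :=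
  X.ray n = t.ray ∧ t.dist ≤ X.len n

open Classical in
/-- The distance covered by a searcher following `X` until the target is reached for the first
time: all iterations before the first successful one are traversed back and forth, and in the
successful one the searcher walks from the origin to the target. It is `⊤` if the target is never
reached. -/
noncomputable def Strategy.cost (X : Strategy m) (t : Target m d₀) : EReal :=
  if h : ∃ n, X.Reaches t n then
    ((2 * ∑ j ∈ Finset.range (Nat.find h), X.len j + t.dist : ℝ) : EReal)
  else ⊤

/-- The competitive ratio of `X`: the supremum of the ratio of the cost and the distance of the
target, over all targets at distance at least `d₀`. -/
noncomputable def competitiveRatio (d₀ : ℝ) (X : Strategy m) : EReal :=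
  ⨆ t : Target m d₀, X.cost t / (t.dist : EReal)

/-- The consistency of the strategy `X` that the searcher follows when the predicted ray is `h`:
its competitive ratio if the prediction is correct, i.e. over the targets on the ray `h`. -/
noncomputable def consistency (d₀ : ℝ) (h : Fin m) (X : Strategy m) : EReal :=
  ⨆ t : {t : Target m d₀ // t.ray = h}, X.cost t.1 / (t.1.dist : EReal)

/-- The robustness of the strategy `X`: its competitive ratio if the prediction is adversarial,
i.e. over all targets, whatever their ray. -/
noncomputable def robustness (d₀ : ℝ) (X : Strategy m) : EReal :=
  competitiveRatio d₀ X

/-- `ρ*_k = k ^ k / (k - 1) ^ (k - 1)` for `k ≥ 1` (with `0 ^ 0 = 1` for `k = 1`). -/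
noncomputable def rhoStar (k : ℕ) : ℝ :=
  (k : ℝ) ^ k / ((k : ℝ) - 1) ^ (k - 1)

end RaySearch

/-! Just before the searcher passes its farthest point `M` on the ray `h`, a target slightly beyond
`M` is still unfound, so consistency bounds the total length so far by `c * M`. The ray `h` has
absorbed at least `M` of it, leaving at most a fraction `(c - 1) / c` for the other rays. If
robustness is `1 + 2 * r`, the same argument on those rays turns the iterations off `h` into a
search of `m - 1` rays with parameter `(c - 1) / c * r` (`Strategy.rhoStar_mul_le_of_covers`).

Such a parameter is at least `rhoStar (m - 1)`. Counting revisits (`rhoStar_le_of_revisit`) makes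
twice iterated partial sums of the lengths satisfy a scalar recurrence, and
`rhoStar_le_of_recurrence` bounds its constant through the smallest growth ratio. -/

namespace RaySearch

/-! ### The scalar recurrence and its extremal constant. -/

open Finset Filter Topology

/-- `rhoStar k` is the minimum of `L ^ k / (L - 1)` over `L > 1`. For `k = n + 1` with `n > 0` the
minimizer is `L = (n + 1) / n`, exactly where the Bernoulli increment `L * n / (n + 1) - 1`
vanishes. -/
theorem rhoStar_mul_le {k : ℕ} (hk : 1 ≤ k) {L : ℝ} (hL : 1 ≤ L) :
    rhoStar k * (L - 1) ≤ L ^ k := by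
  obtain ⟨n, rfl⟩ : ∃ n, k = n + 1 := ⟨k - 1, by omega⟩
  rcases Nat.eq_zero_or_pos n with rfl | hn
  · simp [rhoStar]
  have hn' : (0 : ℝ) < n := by exact_mod_cast hn
  have hs : (0 : ℝ) < (n : ℝ) + 1 := by positivity
  have hb := one_add_mul_le_pow (a := L * n / (n + 1) - 1)
    (by have : 0 ≤ L * n / (n + 1) := by positivity
        linarith) (n + 1)
  have h1 : 1 + ((n + 1 : ℕ) : ℝ) * (L * n / (n + 1) - 1) = n * (L - 1) := by
    push_cast
    field_simp
    ring
  have h2 : (1 + (L * n / (n + 1) - 1)) ^ (n + 1)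
      = L ^ (n + 1) * n ^ n * n / ((n : ℝ) + 1) ^ (n + 1) := by
    rw [add_sub_cancel, div_pow, mul_pow, pow_succ (n : ℝ) n]
    ring
  rw [h1, h2, le_div_iff₀ (by positivity)] at hb
  have h3 : (L - 1) * ((n : ℝ) + 1) ^ (n + 1) ≤ L ^ (n + 1) * n ^ n := by
    refine le_of_mul_le_mul_left ?_ hn'
    linarith
  have h4 : rhoStar (n + 1) = ((n : ℝ) + 1) ^ (n + 1) / (n : ℝ) ^ n := by
    simp [rhoStar]
  rw [h4, div_mul_eq_mul_div, div_le_iff₀ (by positivity)]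
  linarith

/-- If all ratios `A (n + 1) / A n` are at least `L`, the recurrence forces them to be at least `r /
(r - L ^ (k - 1))`. Taking for `L` their infimum gives `L ^ k ≤ r * (L - 1)`. -/
theorem rhoStar_le_of_recurrence {k : ℕ} (hk : 1 ≤ k) {r : ℝ} {A : ℕ → ℝ}
    (hpos : ∀ n, 0 < A n) (hmono : ∀ n, A n < A (n + 1))
    (hrec : ∀ n, A (n + k) ≤ r * (A (n + 1) - A n)) : rhoStar k ≤ r := by
  obtain ⟨k, rfl⟩ : ∃ j, k = j + 1 := ⟨k - 1, by omega⟩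
  set L : ℝ := ⨅ n, A (n + 1) / A n
  have hq : ∀ n, 1 ≤ A (n + 1) / A n := fun n ↦ (one_le_div (hpos n)).2 (hmono n).le
  have hbdd : BddBelow (Set.range fun n ↦ A (n + 1) / A n) :=
    ⟨1, by rintro _ ⟨n, rfl⟩; exact hq n⟩
  have hL1 : 1 ≤ L := le_ciInf hq
  have hLq : ∀ n, L ≤ A (n + 1) / A n := ciInf_le hbdd
  have hstep : ∀ n, L * A n ≤ A (n + 1) := fun n ↦ (le_div_iff₀ (hpos n)).1 (hLq n)
  have hprod : ∀ j n, L ^ j * A n ≤ A (n + j) := by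
    intro j n
    induction j with
    | zero => simp
    | succ j ih =>
      calc L ^ (j + 1) * A n = L * (L ^ j * A n) := by ring
        _ ≤ L * A (n + j) := by gcongr
        _ ≤ A (n + (j + 1)) := hstep _
  have hkey : ∀ n, L ^ k * A (n + 1) ≤ r * (A (n + 1) - A n) := fun n ↦ by
    have := hprod k (n + 1)
    rw [show n + 1 + k = n + (k + 1) by ring] at this
    exact this.trans (hrec n)
  have hr0 : 0 < r := by
    by_contra! hr
    have h1 := hkey 0
    have h2 : 0 < L ^ k * A 1 := mul_pos (by positivity) (hpos 1)
    have h3 := hmono 0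
    simp only [zero_add] at h1 h3
    nlinarith
  have hrL : L ^ k < r := by
    have h1 := hkey 0
    have h2 := mul_pos hr0 (hpos 0)
    have h3 : L ^ k * A (0 + 1) < r * A (0 + 1) := by linarith
    exact lt_of_mul_lt_mul_right h3 (hpos _).le
  -- The exponent is `k` here because the original `k` was replaced by `k + 1`.
  have hle : r / (r - L ^ k) ≤ L := by
    refine le_ciInf fun n ↦ ?_
    rw [div_le_div_iff₀ (by linarith) (hpos n)]
    linarith [hkey n]
  rw [div_le_iff₀ (by linarith)] at hle
  have hfin : L ^ (k + 1) ≤ r * (L - 1) := by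
    rw [pow_succ]
    linarith
  have hL1' : 1 < L := by
    have : 0 < L ^ (k + 1) := by positivity
    by_contra! h
    nlinarith
  exact le_of_mul_le_mul_right ((rhoStar_mul_le hk hL1).trans hfin) (by linarith)

/-! ### Counting revisits in a search of finitely many rays. -/

/-- The `i`-th smallest element of `s`, counted from `0`, is at least `i`. -/
theorem sum_range_card_le_sum {f : ℕ → ℝ} (hf : Monotone f) (s : Finset ℕ) :
    ∑ i ∈ range s.card, f i ≤ ∑ i ∈ s, f i := by
  rw [Finset.sum_range, ← s.sum_coe_sort, ← (s.orderIsoOfFin rfl).toEquiv.sum_comp]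
  refine Finset.sum_le_sum fun i _ ↦ hf ?_
  have : ∀ n (hn : n < s.card), n ≤ ((s.orderIsoOfFin rfl ⟨n, hn⟩ : s) : ℕ) := by
    intro n
    induction n with
    | zero => simp
    | succ n ih =>
      intro hn
      refine Nat.succ_le_of_lt ((ih (by omega)).trans_lt ?_)
      exact (s.orderIsoOfFin rfl).strictMono (Fin.mk_lt_mk.2 n.lt_succ_self)
  exact this i i.2

/-- If each of `k` rays is visited infinitely often, and the total length of the iterations that
precede the next visit to a ray is at most `r` times the length of the last visit to it, then
`r` is at least `ρ*_k`. -/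
theorem rhoStar_le_of_revisit {ι : Type*} [Fintype ι] [Nonempty ι] {y : ℕ → ℝ} {v : ℕ → ι}
    (hy : ∀ i, 0 < y i) (hv : ∀ a N, ∃ n, N < n ∧ v n = a) {r : ℝ}
    (hr : ∀ i j, i < j → v j = v i → (∀ l, i < l → l < j → v l ≠ v i) →
      ∑ l ∈ range j, y l ≤ r * y i) :
    rhoStar (Fintype.card ι) ≤ r := by
  classical
  set S : ℕ → ℝ := fun n ↦ ∑ l ∈ range n, y l with hS
  have hSmono : Monotone S := fun a b hab ↦
    sum_le_sum_of_subset_of_nonneg (range_mono hab) fun i _ _ ↦ (hy i).le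
  have hS0 : ∀ n, 0 ≤ S n := fun n ↦ sum_nonneg fun i _ ↦ (hy i).le
  have hS1 : ∀ n, 1 ≤ n → y 0 ≤ S n := fun n hn ↦ by
    simpa [hS] using hSmono hn
  have hnext : ∀ i, ∃ j, i < j ∧ v j = v i := fun i ↦ hv (v i) i
  have hfirst : ∀ a, ∃ j, v j = a := fun a ↦ (hv a 0).imp fun _ h ↦ h.2
  set next : ℕ → ℕ := fun i ↦ Nat.find (hnext i)
  set first : ι → ℕ := fun a ↦ Nat.find (hfirst a)
  have hn1 : ∀ i, i < next i := fun i ↦ (Nat.find_spec (hnext i)).1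
  have hn2 : ∀ i, v (next i) = v i := fun i ↦ (Nat.find_spec (hnext i)).2
  have hn3 : ∀ i l, i < l → v l = v i → next i ≤ l := fun i l h1 h2 ↦ Nat.find_min' _ ⟨h1, h2⟩
  have hf1 : ∀ a, v (first a) = a := fun a ↦ Nat.find_spec (hfirst a)
  have hf2 : ∀ l, first (v l) ≤ l := fun l ↦ Nat.find_min' _ rfl
  have hnS : ∀ i, S (next i) ≤ r * y i := fun i ↦
    hr i _ (hn1 i) (hn2 i) fun l h1 h2 h3 ↦ (hn3 i l h1 h3).not_gt h2
  have hninj : Function.Injective next := by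
    have key : ∀ i j, i < j → next i ≠ next j := fun i j hij h ↦ by
      have h1 : v j = v i := by rw [← hn2 j, ← h, hn2 i]
      have := hn3 i j hij h1
      have := hn1 j
      omega
    intro i j h
    rcases lt_trichotomy i j with h1 | h1 | h1
    · exact absurd h (key _ _ h1)
    · exact h1
    · exact absurd h.symm (key _ _ h1)
  have hfinj : Function.Injective first := fun a b h ↦ by rw [← hf1 a, h, hf1 b]
  have hr1 : 0 < r := by
    have h1 := (hS1 _ (hn1 0)).trans (hnS 0)
    have h2 := (hy 0).trans_le h1
    exact pos_of_mul_pos_left h2 (hy 0).le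
  have hylow : ∀ i, y 0 / r ≤ y i := fun i ↦ by
    rw [div_le_iff₀ hr1, mul_comm]
    exact (hS1 _ (by have := hn1 i; omega)).trans (hnS i)
  have hSlow : ∀ n : ℕ, n * (y 0 / r) ≤ S n := fun n ↦ by
    simpa using card_nsmul_le_sum (range n) y (y 0 / r) fun i _ ↦ hylow i
  set C : ℝ := ∑ a, S (first a)
  -- The `N` next visits and the first visits, one per ray, are distinct indices, as a first visit
  -- is never a revisit. Since `S` is monotone, the initial segment of the same size has the
  -- smallest sum.
  have hmain : ∀ N, ∑ i ∈ range (N + Fintype.card ι), S i ≤ r * S N + C := by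
    intro N
    have hdisj : Disjoint ((range N).image next) (univ.image first) := by
      rw [Finset.disjoint_left]
      rintro _ h1 h2
      obtain ⟨i, -, rfl⟩ := mem_image.1 h1
      obtain ⟨a, -, ha⟩ := mem_image.1 h2
      have hvi : v i = a := by rw [← hn2 i, ← ha, hf1]
      have h3 := hf2 i
      have h4 := hn1 i
      rw [hvi] at h3
      omega
    have hcard : (((range N).image next) ∪ (univ.image first)).card = N + Fintype.card ι := by
      rw [card_union_of_disjoint hdisj, card_image_of_injective _ hninj,
        card_image_of_injective _ hfinj, card_range, card_univ]
    have h := sum_range_card_le_sum hSmono (((range N).image next) ∪ (univ.image first))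
    rw [hcard, sum_union hdisj, sum_image fun _ _ _ _ h ↦ hninj h,
      sum_image fun _ _ _ _ h ↦ hfinj h] at h
    refine h.trans (add_le_add ?_ le_rfl)
    calc ∑ i ∈ range N, S (next i) ≤ ∑ i ∈ range N, r * y i := sum_le_sum fun i _ ↦ hnS i
      _ = r * S N := by rw [← mul_sum]
  -- `S` grows at least linearly, so any `r' > r` absorbs the constant `C` from some index on.
  refine le_of_forall_gt_imp_ge_of_dense fun r' hr' ↦ ?_
  obtain ⟨n₀, hn₀⟩ := exists_nat_ge (C / ((r' - r) * (y 0 / r)))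
  have hδ : 0 < y 0 / r := div_pos (hy 0) hr1
  rw [div_le_iff₀ (mul_pos (by linarith) hδ)] at hn₀
  -- The extra `2` skips `S 0 = 0`, so that `A` is positive.
  refine rhoStar_le_of_recurrence (A := fun n ↦ ∑ i ∈ range (n₀ + 2 + n), S i)
    Fintype.card_pos (fun n ↦ ?_) (fun n ↦ ?_) (fun n ↦ ?_)
  · refine sum_pos' (fun i _ ↦ hS0 i) ⟨1, by simp; omega, (hy 0).trans_le (hS1 1 le_rfl)⟩
  · rw [← add_assoc, sum_range_succ]
    linarith [(hy 0).trans_le (hS1 (n₀ + 2 + n) (by omega))]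
  · have h1 := hmain (n₀ + 2 + n)
    have h2 := hSlow (n₀ + 2 + n)
    rw [← add_assoc, ← add_assoc, sum_range_succ _ (n₀ + 2 + n), add_sub_cancel_left]
    refine h1.trans ?_
    have h3 : C ≤ (r' - r) * S (n₀ + 2 + n) := by
      calc C ≤ (r' - r) * ((n₀ : ℝ) * (y 0 / r)) := by linarith
        _ ≤ (r' - r) * (((n₀ + 2 + n : ℕ) : ℝ) * (y 0 / r)) := by
          gcongr
          · linarith
        _ ≤ _ := mul_le_mul_of_nonneg_left h2 (by linarith)
    linarith

/-! ### From strategies on the star to the bound on `r`. -/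

/-- Every target on the ray `u` at distance at least `d₀` is reached after iterations of total
length at most `r` times its distance. -/
def Strategy.Covers {m : ℕ} (X : Strategy m) (d₀ r : ℝ) (u : Fin m) : Prop :=
  ∀ d, d₀ ≤ d → ∃ n, X.ray n = u ∧ d ≤ X.len n ∧ (∀ j < n, X.ray j = u → X.len j < d) ∧
    ∑ j ∈ range n, X.len j ≤ r * d

theorem Strategy.covers_of_cost_le {m : ℕ} {X : Strategy m} {d₀ r : ℝ} {u : Fin m} (hd₀ : 0 < d₀)
    (H : ∀ t : Target m d₀, t.ray = u →
      X.cost t / (t.dist : EReal) ≤ ((1 + 2 * r : ℝ) : EReal)) : X.Covers d₀ r u := by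
  intro d hd
  have hdpos : 0 < d := hd₀.trans_le hd
  have h := H ⟨u, d, hd⟩ rfl
  simp only [Strategy.cost] at h
  classical
  split_ifs at h with hex
  · rw [← EReal.coe_div, EReal.coe_le_coe_iff, div_le_iff₀ hdpos] at h
    have hs := Nat.find_spec hex
    refine ⟨Nat.find hex, hs.1, hs.2, fun j hj hju ↦ ?_, ?_⟩
    · by_contra! hle
      exact Nat.find_min hex hj ⟨hju, hle⟩
    · convert (show ∑ j ∈ range (Nat.find hex), X.len j ≤ r * d from ?_)
      have h' : 2 * ∑ j ∈ range (Nat.find hex), X.len j + d ≤ (1 + 2 * r) * d := by convert h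
      linarith
  · rw [EReal.top_div_of_pos_ne_top (by exact_mod_cast hdpos) (EReal.coe_ne_top _)] at h
    exact absurd (top_le_iff.1 h) (EReal.coe_ne_top _)

namespace Strategy

variable {m : ℕ} {X : Strategy m} {d₀ r : ℝ} {u : Fin m}

theorem sum_len_mono (X : Strategy m) {a b : ℕ} (hab : a ≤ b) :
    ∑ j ∈ range a, X.len j ≤ ∑ j ∈ range b, X.len j :=
  sum_le_sum_of_subset_of_nonneg (range_mono hab) fun i _ _ ↦ (X.len_pos i).le

/-- Targets at distance `d > M` are not reached before iteration `n`; let `d` decrease to `M`. -/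
theorem Covers.sum_le (hX : X.Covers d₀ r u) {n : ℕ} {M : ℝ} (hM : d₀ ≤ M)
    (hmax : ∀ j < n, X.ray j = u → X.len j ≤ M) : ∑ j ∈ range n, X.len j ≤ r * M := by
  have hc : Tendsto (fun d : ℝ ↦ r * d) (𝓝[>] M) (𝓝 (r * M)) :=
    ((continuous_const.mul continuous_id).tendsto M).mono_left nhdsWithin_le_nhds
  refine ge_of_tendsto hc ?_
  filter_upwards [self_mem_nhdsWithin] with d hd
  obtain ⟨n', h1, h2, -, h4⟩ := hX d (hM.trans (le_of_lt hd))
  have : n ≤ n' := by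
    by_contra! hlt
    exact absurd (hmax n' hlt h1) (not_le.2 (lt_of_lt_of_le hd h2))
  exact (X.sum_len_mono this).trans h4

/-- The total length of the iterations before `n` on the ray `u`. -/
noncomputable def onRay (X : Strategy m) (u : Fin m) (n : ℕ) : ℝ :=
  ∑ j ∈ (range n).filter (fun j ↦ X.ray j = u), X.len j

/-- The total length of the iterations before `n` on the rays other than `u`. -/
noncomputable def offRay (X : Strategy m) (u : Fin m) (n : ℕ) : ℝ :=
  ∑ j ∈ (range n).filter (fun j ↦ X.ray j ≠ u), X.len j

theorem onRay_add_offRay (X : Strategy m) (u : Fin m) (n : ℕ) :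
    X.onRay u n + X.offRay u n = ∑ j ∈ range n, X.len j :=
  sum_filter_add_sum_filter_not _ _ _

theorem exists_max_onRay {n i : ℕ} (hi : i < n) (hiu : X.ray i = u) :
    ∃ q < n, X.ray q = u ∧ ∀ j < n, X.ray j = u → X.len j ≤ X.len q := by
  obtain ⟨q, hq, hmax⟩ := exists_max_image ((range n).filter fun j ↦ X.ray j = u) X.len
    ⟨i, by simp [hi, hiu]⟩
  simp only [mem_filter, mem_range] at hq hmax
  exact ⟨q, hq.1, hq.2, fun j hj hju ↦ hmax j ⟨hj, hju⟩⟩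

/-- Two distinct iterations on `u` make the total length strictly exceed the longest one. -/
theorem Covers.one_lt (hd₀ : 0 < d₀) (hX : X.Covers d₀ r u) : 1 < r := by
  obtain ⟨a, ha, had, -⟩ := hX d₀ le_rfl
  obtain ⟨b, hb, hbd, -⟩ := hX (X.len a + d₀) (by linarith [X.len_pos a])
  have hab : a ≠ b := by
    rintro rfl
    linarith
  set n := max a b + 1 with hn
  obtain ⟨q, hq, hqu, hmax⟩ := exists_max_onRay (X := X) (n := n) (by omega) ha
  have hM : d₀ ≤ X.len q := had.trans (hmax a (by omega) ha)
  have h := hX.sum_le hM hmax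
  have hlt : X.len q < ∑ j ∈ range n, X.len j := by
    obtain ⟨p, hp, hpq⟩ : ∃ p < n, p ≠ q := by
      by_cases h : a = q
      · exact ⟨b, by omega, by omega⟩
      · exact ⟨a, by omega, h⟩
    exact single_lt_sum hpq (mem_range.2 hq) (mem_range.2 hp) (X.len_pos p)
      fun i _ _ ↦ (X.len_pos i).le
  have h2 : 1 * X.len q < r * X.len q := by linarith
  exact lt_of_mul_lt_mul_right h2 (X.len_pos q).le

theorem Covers.offRay_le (hX : X.Covers d₀ r u) {n i : ℕ} (hi : i < n) (hiu : X.ray i = u)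
    (hid : d₀ ≤ X.len i) (hr : 0 ≤ r) : r * X.offRay u n ≤ (r - 1) * ∑ j ∈ range n, X.len j := by
  obtain ⟨q, hq, hqu, hmax⟩ := exists_max_onRay hi hiu
  have h := hX.sum_le (hid.trans (hmax i hi hiu)) hmax
  have h1 : X.len q ≤ X.onRay u n :=
    single_le_sum (f := X.len) (fun j _ ↦ (X.len_pos j).le) (by simp [hq, hqu])
  have h2 := X.onRay_add_offRay u n
  have h3 := mul_le_mul_of_nonneg_left h1 hr
  have h4 : X.offRay u n = ∑ j ∈ range n, X.len j - X.onRay u n := by linarith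
  rw [h4]
  linarith

/-- The iterations on a ray other than `h` that go farther than `D` and farther than all previous
iterations on the same ray. -/
def records (X : Strategy m) (h : Fin m) (D : ℝ) : Set ℕ :=
  {n | D < X.len n ∧ X.ray n ≠ h ∧ ∀ j < n, X.ray j = X.ray n → X.len j < X.len n}

theorem Covers.exists_record (hX : X.Covers d₀ r u) {h : Fin m} (hu : u ≠ h) {D : ℝ}
    (hD : d₀ ≤ D) (N : ℕ) : ∃ n, N < n ∧ n ∈ X.records h D ∧ X.ray n = u := by
  have hS : ∀ j < N + 1, X.len j ≤ ∑ j ∈ range (N + 1), X.len j := fun j hj ↦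
    single_le_sum (fun j _ ↦ (X.len_pos j).le) (mem_range.2 hj)
  have hS0 : 0 ≤ ∑ j ∈ range (N + 1), X.len j := sum_nonneg fun j _ ↦ (X.len_pos j).le
  obtain ⟨n, h1, h2, h3, -⟩ := hX (|D| + 1 + ∑ j ∈ range (N + 1), X.len j)
    (by linarith [le_abs_self D])
  refine ⟨n, ?_, ⟨by linarith [le_abs_self D], by rwa [h1], fun j hj hju ↦ ?_⟩, h1⟩
  · by_contra! hle
    linarith [hS n (by omega), abs_nonneg D]
  · exact (h3 j hj (hju.trans h1)).trans_le h2

theorem rhoStar_mul_le_of_covers (hm : 2 ≤ m) (hd₀ : 0 < d₀) {h : Fin m} {c : ℝ}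
    (hc : X.Covers d₀ c h) (hr : ∀ u, X.Covers d₀ r u) :
    rhoStar (m - 1) * (1 + 1 / (c - 1)) ≤ r := by
  have hc1 := hc.one_lt hd₀
  obtain ⟨i₀, hi₀, hi₀d, -⟩ := hc d₀ le_rfl
  -- Exceeding every length up to iteration `i₀` puts all records after `i₀`, when `h` has already
  -- been explored to `d₀`, as `offRay_le` needs.
  set D : ℝ := d₀ + ∑ j ∈ range (i₀ + 1), X.len j
  have hS0 : 0 ≤ ∑ j ∈ range (i₀ + 1), X.len j := sum_nonneg fun j _ ↦ (X.len_pos j).le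
  have hD : d₀ ≤ D := by linarith
  have hrec : ∀ n ∈ X.records h D, i₀ < n := fun n hn ↦ by
    by_contra! hle
    have h1 : X.len n ≤ ∑ j ∈ range (i₀ + 1), X.len j :=
      single_le_sum (fun j _ ↦ (X.len_pos j).le) (mem_range.2 (by omega))
    linarith [hn.1]
  have : Nontrivial (Fin m) := Fin.nontrivial_iff_two_le.2 hm
  obtain ⟨u₀, hu₀⟩ := exists_ne h
  have : Nonempty {u : Fin m // u ≠ h} := ⟨⟨u₀, hu₀⟩⟩
  have hinf : (Set.ofPred (· ∈ X.records h D)).Infinite :=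
    Set.infinite_of_forall_exists_gt fun N ↦ by
      obtain ⟨n, h1, h2, -⟩ := (hr u₀).exists_record hu₀ hD N
      exact ⟨n, h2, h1⟩
  set e : ℕ → ℕ := Nat.nth (· ∈ X.records h D) with he
  have hemono : StrictMono e := Nat.nth_strictMono hinf
  have hemem : ∀ i, e i ∈ X.records h D := fun i ↦ Nat.nth_mem_of_infinite hinf i
  have hesurj : ∀ n ∈ X.records h D, ∃ i, e i = n := fun n hn ↦ by
    have : n ∈ Set.range e := by
      rw [he, Nat.range_nth_of_infinite hinf]
      exact hn
    exact this
  have key : rhoStar (Fintype.card {u : Fin m // u ≠ h}) ≤ (c - 1) / c * r := by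
    refine rhoStar_le_of_revisit (y := fun i ↦ X.len (e i))
      (v := fun i ↦ (⟨X.ray (e i), (hemem i).2.1⟩ : {u : Fin m // u ≠ h}))
      (fun i ↦ X.len_pos _) ?_ ?_
    · rintro ⟨u, hu⟩ N
      obtain ⟨n, h1, h2, h3⟩ := (hr u).exists_record hu hD (e N)
      obtain ⟨i, rfl⟩ := hesurj n h2
      exact ⟨i, hemono.lt_iff_lt.1 h1, Subtype.ext h3⟩
    · intro i j hij hv hbetween
      have hvij : X.ray (e j) = X.ray (e i) := congrArg Subtype.val hv
      -- The earliest iteration on this ray to exceed `X.len (e i)` would be a record strictly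
      -- between two consecutive records.
      have hmax : ∀ q < e j, X.ray q = X.ray (e i) → X.len q ≤ X.len (e i) := by
        intro q
        induction q using Nat.strong_induction_on with
        | _ q ih =>
          intro hqj hq
          by_contra! hlt
          have hqrec : q ∈ X.records h D :=
            ⟨(hemem i).1.trans hlt, by rw [hq]; exact (hemem i).2.1, fun p hp hpq ↦
              (ih p hp (hp.trans hqj) (hpq.trans hq)).trans_lt hlt⟩
          obtain ⟨l, rfl⟩ := hesurj q hqrec
          have hil : i < l := by
            by_contra! hle
            rcases hle.eq_or_lt with rfl | hli
            · exact lt_irrefl _ hlt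
            · exact lt_asymm hlt ((hemem i).2.2 _ (hemono hli) hq)
          exact hbetween l hil (hemono.lt_iff_lt.1 hqj) (Subtype.ext hq)
      have h1 := (hr (X.ray (e i))).sum_le (hD.trans (hemem i).1.le) hmax
      have h2 := hc.offRay_le (hrec _ (hemem j)) hi₀ hi₀d (by linarith)
      have h3 : ∑ l ∈ range j, X.len (e l) ≤ X.offRay h (e j) := by
        rw [← sum_image (f := X.len) (g := e) fun a _ b _ hab ↦ hemono.injective hab]
        refine sum_le_sum_of_subset_of_nonneg (fun q hq ↦ ?_) fun q _ _ ↦ (X.len_pos q).le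
        obtain ⟨l, hl, rfl⟩ := mem_image.1 hq
        exact mem_filter.2 ⟨mem_range.2 (hemono (mem_range.1 hl)), (hemem l).2.1⟩
      refine h3.trans ?_
      rw [div_mul_eq_mul_div, div_mul_eq_mul_div, le_div_iff₀ (by linarith)]
      have h4 := mul_le_mul_of_nonneg_left h1 (by linarith : 0 ≤ c - 1)
      linarith
  have hcard : Fintype.card {u : Fin m // u ≠ h} = m - 1 := by
    rw [Fintype.card_subtype_compl, Fintype.card_fin, Fintype.card_subtype_eq]
  rw [hcard] at key
  have hc0 : 0 < c - 1 := by linarith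
  rw [show 1 + 1 / (c - 1) = c / (c - 1) by field_simp; ring, ← mul_div_assoc, div_le_iff₀ hc0]
  rw [div_mul_eq_mul_div, le_div_iff₀ (by linarith)] at key
  linarith

end Strategy

theorem one_lt_and_le_robustness {m : ℕ} (hm : 2 ≤ m) {d₀ : ℝ} (hd₀ : 0 < d₀) {h : Fin m}
    {X : Strategy m} {c : ℝ} (hX : consistency d₀ h X ≤ ((1 + 2 * c : ℝ) : EReal)) :
    1 < c ∧ ((1 + 2 * rhoStar (m - 1) * (1 + 1 / (c - 1)) : ℝ) : EReal) ≤ robustness d₀ X := by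
  have hc : X.Covers d₀ c h := Strategy.covers_of_cost_le hd₀ fun t ht ↦
    (le_iSup (fun t : {t : Target m d₀ // t.ray = h} ↦ X.cost t.1 / (t.1.dist : EReal))
      ⟨t, ht⟩).trans hX
  refine ⟨hc.one_lt hd₀, ?_⟩
  by_contra! hlt
  -- A real `b` above the robustness supplies a real parameter `(b - 1) / 2` for every ray.
  obtain ⟨b, hb1, hb2⟩ := EReal.lt_iff_exists_real_btwn.1 hlt
  rw [EReal.coe_lt_coe_iff] at hb2
  have hr : ∀ u, X.Covers d₀ ((b - 1) / 2) u := fun u ↦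
    Strategy.covers_of_cost_le hd₀ fun t _ ↦ by
      rw [show 1 + 2 * ((b - 1) / 2) = b by ring]
      exact (le_iSup (fun t : Target m d₀ ↦ X.cost t / (t.dist : EReal)) t).trans hb1.le
  have := Strategy.rhoStar_mul_le_of_covers hm hd₀ hc hr
  linarith

/-! ### Asymptotics in `m`. -/

/-- For `n > 0` the quotient equals `(1 + 1 / n) ^ n`. -/
theorem tendsto_rhoStar_succ_div :
    Tendsto (fun n : ℕ ↦ rhoStar (n + 1) / (n + 1 : ℝ)) atTop (𝓝 (Real.exp 1)) := by
  refine (Real.tendsto_one_add_div_pow_exp 1).congr' ?_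
  filter_upwards [eventually_gt_atTop 0] with n hn
  have hn' : (0 : ℝ) < n := by exact_mod_cast hn
  rw [show 1 + 1 / (n : ℝ) = (n + 1) / n by field_simp, div_pow]
  simp only [rhoStar, Nat.cast_add, Nat.cast_one, add_sub_cancel_right, Nat.add_sub_cancel]
  rw [pow_succ]
  field_simp

theorem exists_forall_le_rhoStar {ε : ℝ} (hε : 0 < ε) :
    ∃ M : ℕ, ∀ m : ℕ, M ≤ m → (1 - ε) * (Real.exp 1 * ((m : ℝ) - 1)) ≤ rhoStar (m - 1) := by
  have hlt : (1 - ε) * Real.exp 1 < Real.exp 1 := by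
    have := mul_pos hε (Real.exp_pos 1)
    linarith
  obtain ⟨M, hM⟩ := eventually_atTop.1 (tendsto_rhoStar_succ_div.eventually_const_lt hlt)
  refine ⟨M + 2, fun m hm ↦ ?_⟩
  obtain ⟨n, rfl⟩ : ∃ n, m = n + 2 := ⟨m - 2, by omega⟩
  have h := hM n (by omega)
  rw [lt_div_iff₀ (by positivity)] at h
  rw [show n + 2 - 1 = n + 1 by omega]
  push_cast
  linarith

end RaySearch

theorem mainTheorem5 :
    (∀ m : ℕ, 2 ≤ m → ∀ d₀ : ℝ, 0 < d₀ →
      ∀ (h : Fin m) (X : RaySearch.Strategy m) (c : ℝ),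
        RaySearch.consistency d₀ h X ≤ ((1 + 2 * c : ℝ) : EReal) →
          1 < c ∧
          ((1 + 2 * RaySearch.rhoStar (m - 1) * (1 + 1 / (c - 1)) : ℝ) : EReal) ≤
            RaySearch.robustness d₀ X) ∧
    (∀ ε : ℝ, 0 < ε → ∃ M : ℕ, ∀ m : ℕ, M ≤ m → ∀ d₀ : ℝ, 0 < d₀ →
      ∀ (h : Fin m) (X : RaySearch.Strategy m) (c : ℝ),
        RaySearch.consistency d₀ h X ≤ ((1 + 2 * c : ℝ) : EReal) →
          (((1 - ε) * (1 + 2 * Real.exp 1 * ((m : ℝ) - 1) * (1 + 1 / (c - 1))) : ℝ) : EReal) ≤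
            RaySearch.robustness d₀ X) := by
  refine ⟨fun m hm d₀ hd₀ h X c hX ↦ RaySearch.one_lt_and_le_robustness hm hd₀ hX,
    fun ε hε ↦ ?_⟩
  obtain ⟨M, hM⟩ := RaySearch.exists_forall_le_rhoStar hε
  refine ⟨max M 2, fun m hm d₀ hd₀ h X c hX ↦ ?_⟩
  obtain ⟨hc, hR⟩ := RaySearch.one_lt_and_le_robustness (le_of_max_le_right hm) hd₀ hX
  refine le_trans (EReal.coe_le_coe_iff.2 ?_) hR
  have h1 : 0 < 1 + 1 / (c - 1) := by
    have : 0 < c - 1 := by linarith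
    positivity
  have h2 := mul_le_mul_of_nonneg_right (hM m (le_of_max_le_left hm)) h1.le
  linarith
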